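/- For an integer $n>0$ that is not a perfect square, let $h(n)$ denote the class number of the real quadratic field $\mathbb{Q}(\sqrt{n})$. Let $k \geq 1$ be an integer and let $M > 0$ be a real number. Then there exist infinitely many square-free integers $d > 0$ such that, for every $j = 1,\ldots,k$, the integer $jd$ is not a perfect square and $h(jd) > M$. More precisely, let $t \geq 0$ be an integer with $2^t > M$, let $p_1,\ldots,p_{t+2}$ be distinct prime numbers, all larger than $k$, and put $d = p_1 p_2\cdots p_{t+2}$. Then $d$ is square-free and, for every $j = 1,\ldots,k$, the integer $jd$ is not a perfect square, $2^t$ divides $h(jd)$, and $h(jd) > M$. -/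

import Mathlib

/-- The field `ℚ(√n)`, as a subfield of the real numbers; for `n` not a perfect square it is a
real quadratic field. -/
noncomputable abbrev realQuadField (n : ℕ) : IntermediateField ℚ ℝ :=
  IntermediateField.adjoin ℚ {Real.sqrt (n : ℝ)}

instance realQuadField_numberField (n : ℕ) : NumberField (realQuadField n) where
  to_charZero := inferInstance
  to_finiteDimensional := by
    apply IntermediateField.adjoin.finiteDimensional
    refine ⟨Polynomial.X ^ 2 - Polynomial.C (n : ℚ),
      Polynomial.monic_X_pow_sub_C _ two_ne_zero, ?_⟩
    simp

/-- `h(n)`: the class number of `ℚ(√n)`. -/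
noncomputable def quadClassNumber (n : ℕ) : ℕ :=
  NumberField.classNumber (realQuadField n)

/-! Put `n = j * d`. Each prime `p ∈ S` divides `n` exactly once, so it ramifies: `(p, √n) ^ 2 =
(p)`. Products of these ideals over the `2 ^ (t + 2)` subsets of `S` give classes in the 2-torsion
`G` of the class group. If the subsets `T` and `U` give the same class, then `∏ T * ∏ U` times a
positive unit is a square. Positive units fill at most two square classes
(`exists_unit_isSquare_or_isSquare_mul`), and each square class of `ℚ(√n)` contains at most two
subset products (`realQuadField.card_le_two`). So at most four subsets share a class, `G` has order
at least `2 ^ t`, and Lagrange's theorem concludes. -/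

open NumberField nonZeroDivisors

/-! ### Units and ideal classes modulo squares -/

/-- Let `K` be a number field of degree at most `2` with a real embedding `φ`. Up to squares there
are at most two units that are positive under `φ`. -/
theorem exists_unit_isSquare_or_isSquare_mul {K : Type*} [Field K] [NumberField K] (φ : K →+* ℝ)
    (hK : Module.finrank ℚ K ≤ 2) :
    ∃ ε : (𝓞 K)ˣ, ∀ u : (𝓞 K)ˣ, 0 < φ u → IsSquare u ∨ IsSquare (ε * u) := by
  classical
  have htors : ∀ ζ ∈ Units.torsion K, ζ = 1 ∨ ζ = -1 := by
    intro ζ hζ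
    obtain ⟨m, hm, h⟩ := isOfFinOrder_iff_pow_eq_one.1 hζ
    have h1 : φ ζ ^ m = 1 := by
      rw [← map_pow, ← Units.coe_pow, h]
      simp
    have h2 : |φ ζ| = 1 := by
      rw [← pow_eq_one_iff_of_nonneg (abs_nonneg _) hm.ne', ← abs_pow, h1, abs_one]
    rcases eq_or_eq_neg_of_abs_eq h2 with h3 | h3
    · left
      apply Units.coe_injective K
      apply φ.injective
      simpa using h3
    · right
      apply Units.coe_injective K
      apply φ.injective
      simpa using h3
  -- Every infinite place comes from an embedding, so there are at most two places, and the rank is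
  -- one less than their number.
  have hrank : Units.rank K ≤ 1 := by
    have h := Fintype.card_le_of_surjective (fun ψ : K →+* ℂ => InfinitePlace.mk ψ)
      (fun w => ⟨w.embedding, InfinitePlace.mk_embedding w⟩)
    rw [Embeddings.card] at h
    unfold Units.rank
    omega
  have hgen : ∃ η : (𝓞 K)ˣ, ∀ u : (𝓞 K)ˣ, ∃ e : ℤ, u = η ^ e ∨ u = -η ^ e := by
    rcases Nat.le_one_iff_eq_zero_or_eq_one.1 hrank with h | h
    · refine ⟨1, fun u => ⟨0, ?_⟩⟩
      obtain ⟨⟨ζ, e⟩, hu, -⟩ := Units.exist_unique_eq_mul_prod K u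
      have : IsEmpty (Fin (Units.rank K)) := by rw [h]; infer_instance
      simp only [Finset.univ_eq_empty, Finset.prod_empty, mul_one] at hu
      rcases htors ζ ζ.2 with h | h <;> simp [hu, h]
    · have i0 : Fin (Units.rank K) := ⟨0, by omega⟩
      have : Subsingleton (Fin (Units.rank K)) := by rw [h]; infer_instance
      refine ⟨Units.fundSystem K i0, fun u => ?_⟩
      obtain ⟨⟨ζ, e⟩, hu, -⟩ := Units.exist_unique_eq_mul_prod K u
      refine ⟨e i0, ?_⟩
      rw [Fintype.prod_subsingleton _ i0] at hu
      rcases htors ζ ζ.2 with h | h <;> simp [hu, h]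
  -- The sign of `η` can be chosen: this makes every `-η ^ e` negative under `φ`.
  have hpos : ∃ η : (𝓞 K)ˣ, 0 < φ η ∧ ∀ u : (𝓞 K)ˣ, ∃ e : ℤ, u = η ^ e ∨ u = -η ^ e := by
    obtain ⟨η, hη⟩ := hgen
    have hne : φ η ≠ 0 := (map_ne_zero φ).2 (Units.coe_ne_zero η)
    rcases lt_or_gt_of_ne hne with h | h
    · refine ⟨-η, by simpa using h, fun u => ?_⟩
      obtain ⟨e, he⟩ := hη u
      refine ⟨e, ?_⟩
      rcases Int.even_or_odd e with h | h
      · rwa [h.neg_zpow]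
      · rwa [h.neg_zpow, neg_neg, or_comm]
    · exact ⟨η, h, hη⟩
  obtain ⟨η, hη, hgen⟩ := hpos
  refine ⟨η, fun u hu => ?_⟩
  obtain ⟨e, rfl | rfl⟩ := hgen u
  · rcases Int.even_or_odd e with h | h
    · exact Or.inl (h.isSquare_zpow η)
    · right
      rw [← zpow_one_add]
      exact (odd_one.add_odd h).isSquare_zpow η
  · have : 0 < φ η ^ e := zpow_pos hη e
    have hneg : φ ((-η ^ e : (𝓞 K)ˣ) : K) = -φ η ^ e := by
      rw [Units.val_neg, map_neg, Units.coe_zpow, map_neg, map_zpow₀]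
    rw [hneg] at hu
    linarith

/-- The generators `p ^ 2`, `p * θ`, `θ ^ 2` are multiples of `p`; conversely `a * p + b * c = 1`
gives `p = a * p ^ 2 + b * θ ^ 2`. -/
theorem Ideal.span_pair_sq_eq {R : Type*} [CommRing R] {p c θ : R} (h : θ ^ 2 = p * c)
    (hpc : IsCoprime p c) : Ideal.span {p, θ} ^ 2 = Ideal.span {p} := by
  rw [pow_two, Ideal.span_pair_mul_span_pair]
  apply le_antisymm
  · rw [Ideal.span_le]
    intro x hx
    simp only [Set.mem_insert_iff, Set.mem_singleton_iff] at hx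
    rw [SetLike.mem_coe, Ideal.mem_span_singleton]
    rcases hx with rfl | rfl | rfl | rfl
    · exact dvd_mul_right _ _
    · exact dvd_mul_right _ _
    · exact dvd_mul_left _ _
    · exact ⟨c, by rw [← h, pow_two]⟩
  · rw [Ideal.span_singleton_le_iff_mem]
    obtain ⟨a, b, hab⟩ := hpc
    have hp : p = a * (p * p) + b * (θ * θ) := by
      rw [← pow_two θ, h]
      linear_combination (-p) * hab
    rw [hp]
    exact Ideal.add_mem _ (Ideal.mul_mem_left _ _ (Ideal.subset_span (by simp [← hp])))
      (Ideal.mul_mem_left _ _ (Ideal.subset_span (by simp)))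

/-- If the ideals `I` and `J` have principal squares generated by the positive integers `a` and `b`
and lie in the same class, then `a * b` is a unit times a square. -/
theorem exists_unit_isSquare_of_mk0_eq {K : Type*} [Field K] [NumberField K] (φ : K →+* ℝ)
    {I J : (Ideal (𝓞 K))⁰} {a b : ℕ} (ha : 0 < a) (hb : 0 < b)
    (hI : (I : Ideal (𝓞 K)) ^ 2 = Ideal.span {(a : 𝓞 K)})
    (hJ : (J : Ideal (𝓞 K)) ^ 2 = Ideal.span {(b : 𝓞 K)})
    (h : ClassGroup.mk0 I = ClassGroup.mk0 J) :
    ∃ u : (𝓞 K)ˣ, 0 < φ u ∧ IsSquare ((u : K) * (a * b)) := by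
  obtain ⟨x, y, hx, hy, hxy⟩ := ClassGroup.mk0_eq_mk0_iff.1 h
  have hspan : Ideal.span {y ^ 2 * (b : 𝓞 K)} = Ideal.span {x ^ 2 * (a : 𝓞 K)} := by
    have := congrArg (· ^ 2) hxy
    simp only [mul_pow, hI, hJ, Ideal.span_singleton_pow, Ideal.span_singleton_mul_span_singleton]
      at this
    exact this.symm
  obtain ⟨u, hu⟩ := Ideal.span_singleton_eq_span_singleton.1 hspan
  have huK : (y : K) ^ 2 * b * u = (x : K) ^ 2 * a := by
    have := congrArg (algebraMap (𝓞 K) K) hu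
    simpa using this
  have hxK : (x : K) ≠ 0 := by simpa using hx
  have hyK : (y : K) ≠ 0 := by simpa using hy
  refine ⟨u, ?_, ⟨(x : K) * a / y, ?_⟩⟩
  · have h1 : φ y ^ 2 * b * φ u = φ x ^ 2 * a := by
      have := congrArg φ huK
      simpa using this
    have h2 : 0 < φ y ^ 2 * b := by
      have := (map_ne_zero φ).2 hyK
      positivity
    have h3 : 0 < φ x ^ 2 * a := by
      have := (map_ne_zero φ).2 hxK
      positivity
    rw [← h1] at h3
    exact pos_of_mul_pos_right h3 h2.le
  · field_simp
    linear_combination (a : K) * huK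

/-! ### Square classes of integers in `ℚ(√n)` -/

theorem realQuadField.exists_eq_add_mul_sqrt {n : ℕ} {z : ℝ} (hz : z ∈ realQuadField n) :
    ∃ x y : ℚ, z = x + y * √(n : ℝ) := by
  have halg : IsAlgebraic ℚ (√(n : ℝ)) :=
    ⟨Polynomial.X ^ 2 - Polynomial.C (n : ℚ),
      (Polynomial.monic_X_pow_sub_C _ two_ne_zero).ne_zero, by simp⟩
  rw [← IntermediateField.mem_toSubalgebra,
    IntermediateField.adjoin_simple_toSubalgebra_of_isAlgebraic halg] at hz
  induction hz using Algebra.adjoin_induction with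
  | mem x hx => exact ⟨0, 1, by simpa using hx⟩
  | algebraMap r => exact ⟨r, 0, by simp⟩
  | add x y _ _ hx hy =>
    obtain ⟨a, b, rfl⟩ := hx
    obtain ⟨c, d, rfl⟩ := hy
    exact ⟨a + c, b + d, by push_cast; ring⟩
  | mul x y _ _ hx hy =>
    obtain ⟨a, b, rfl⟩ := hx
    obtain ⟨c, d, rfl⟩ := hy
    refine ⟨a * c + b * d * n, a * d + b * c, ?_⟩
    have := Real.sq_sqrt (Nat.cast_nonneg (α := ℝ) n)
    push_cast
    linear_combination (b * d : ℝ) * this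

theorem realQuadField.finrank_le (n : ℕ) : Module.finrank ℚ (realQuadField n) ≤ 2 := by
  have hroot : Polynomial.aeval (√(n : ℝ)) (Polynomial.X ^ 2 - Polynomial.C (n : ℚ)) = 0 := by
    simp
  have hmonic := Polynomial.monic_X_pow_sub_C (n : ℚ) two_ne_zero
  rw [IntermediateField.adjoin.finrank ⟨_, hmonic, hroot⟩]
  refine (Polynomial.natDegree_le_of_dvd (minpoly.dvd ℚ _ hroot) hmonic.ne_zero).trans ?_
  rw [Polynomial.natDegree_X_pow_sub_C]

/-- In `a = (x + y√n) ^ 2` irrationality of `√n` forces `x * y = 0`: either `a = x ^ 2` or `n * a =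
(n * y) ^ 2`. -/
theorem realQuadField.isSquare_or_isSquare_mul {n : ℕ} (hn : ¬ IsSquare n) {a : ℕ}
    (ha : IsSquare (a : realQuadField n)) : IsSquare a ∨ IsSquare (n * a) := by
  obtain ⟨z, hz⟩ := ha
  obtain ⟨x, y, hxy⟩ := realQuadField.exists_eq_add_mul_sqrt z.2
  have hirr : Irrational √(n : ℝ) := irrational_sqrt_natCast_iff.2 hn
  have hsq := Real.sq_sqrt (Nat.cast_nonneg (α := ℝ) n)
  have haR : (a : ℝ) = (z : ℝ) * z := by
    have := congrArg (fun w : realQuadField n => (w : ℝ)) hz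
    simpa using this
  rw [hxy] at haR
  have hlin : (((2 * x * y : ℚ) : ℝ)) * √(n : ℝ) = ((a - x ^ 2 - y ^ 2 * n : ℚ) : ℝ) := by
    push_cast
    linear_combination -haR - (y : ℝ) ^ 2 * hsq
  have hxy0 : 2 * x * y = 0 := by
    by_contra h
    exact (hirr.ratCast_mul h) ⟨_, hlin.symm⟩
  have hrat : (a : ℚ) - x ^ 2 - y ^ 2 * n = 0 := by
    rw [hxy0] at hlin
    have : ((a - x ^ 2 - y ^ 2 * n : ℚ) : ℝ) = 0 := by rw [← hlin]; simp
    exact_mod_cast this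
  rcases mul_eq_zero.1 hxy0 with h | h
  · right
    have hx : x = 0 := by simpa using h
    rw [← Rat.isSquare_natCast_iff]
    refine ⟨n * y, ?_⟩
    rw [hx] at hrat
    push_cast
    linear_combination (n : ℚ) * hrat
  · left
    rw [← Rat.isSquare_natCast_iff]
    refine ⟨x, ?_⟩
    rw [h] at hrat
    linear_combination hrat

theorem Nat.squarefree_prod_of_forall_prime {S : Finset ℕ} (hS : ∀ p ∈ S, p.Prime) :
    Squarefree (∏ p ∈ S, p) := by
  classical
  induction S using Finset.induction_on with
  | empty => simp
  | insert p T hp ih =>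
    rw [Finset.prod_insert hp, Nat.squarefree_mul_iff]
    refine ⟨?_, (hS p (by simp)).squarefree, ih fun q hq => hS q (by simp [hq])⟩
    refine Nat.Coprime.prod_right fun q hq => ?_
    refine (Nat.coprime_primes (hS p (by simp)) (hS q (by simp [hq]))).2 ?_
    rintro rfl
    exact hp hq

theorem Nat.Prime.sq_dvd_of_isSquare {p m : ℕ} (hp : p.Prime) (hm : IsSquare m) (h : p ∣ m) :
    p ^ 2 ∣ m := by
  obtain ⟨r, rfl⟩ := hm
  rw [← pow_two] at h ⊢
  exact pow_dvd_pow_of_dvd (hp.dvd_of_dvd_pow h) 2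

theorem Nat.subset_of_isSquare_prod_mul_prod {T U : Finset ℕ} (hT : ∀ p ∈ T, p.Prime)
    (hU : ∀ p ∈ U, p.Prime) (h : IsSquare ((∏ p ∈ T, p) * ∏ p ∈ U, p)) : T ⊆ U := by
  intro p hp
  by_contra hpU
  have hpp := hT p hp
  have hcop : Nat.Coprime (p ^ 2) (∏ q ∈ U, q) := by
    refine Nat.Coprime.prod_right fun q hq => Nat.Coprime.pow_left 2 ?_
    refine (Nat.coprime_primes hpp (hU q hq)).2 ?_
    rintro rfl
    exact hpU hq
  have hdvd : p ^ 2 ∣ ∏ q ∈ T, q := hcop.dvd_of_dvd_mul_right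
    (hpp.sq_dvd_of_isSquare h ((Finset.dvd_prod_of_mem _ hp).mul_right _))
  rw [pow_two] at hdvd
  exact hpp.not_isUnit (Nat.squarefree_prod_of_forall_prime hT p hdvd)

theorem Nat.eq_of_isSquare_prod_mul_prod {T U : Finset ℕ} (hT : ∀ p ∈ T, p.Prime)
    (hU : ∀ p ∈ U, p.Prime) (h : IsSquare ((∏ p ∈ T, p) * ∏ p ∈ U, p)) : T = U :=
  (Nat.subset_of_isSquare_prod_mul_prod hT hU h).antisymm
    (Nat.subset_of_isSquare_prod_mul_prod hU hT (by rwa [mul_comm]))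

theorem isSquare_mul_of_isSquare_mul_left {F : Type*} [Field F] {c a b : F} (hc : c ≠ 0)
    (ha : IsSquare (c * a)) (hb : IsSquare (c * b)) : IsSquare (a * b) := by
  obtain ⟨r, hr⟩ := ha
  obtain ⟨s, hs⟩ := hb
  refine ⟨r * s / c, ?_⟩
  field_simp
  linear_combination c * b * hr + r ^ 2 * hs

/-- A class modulo squares of `ℚ(√n)` contains at most two products of distinct primes. -/
theorem realQuadField.card_le_two {n : ℕ} (hn : ¬ IsSquare n) {F : Finset (Finset ℕ)}
    (hF : ∀ T ∈ F, ∀ p ∈ T, p.Prime) {c : realQuadField n} (hc : c ≠ 0)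
    (h : ∀ T ∈ F, IsSquare (c * ((∏ p ∈ T, p : ℕ) : realQuadField n))) : F.card ≤ 2 := by
  by_contra! hcard
  obtain ⟨T, hT, U, hU, V, hV, hTU, hTV, hUV⟩ := Finset.two_lt_card.1 hcard
  -- For three distinct sets, `n * ∏ T * ∏ U` and `n * ∏ T * ∏ V` are squares, hence so is `∏ U * ∏
  -- V`, which forces `U = V`.
  have key : ∀ A ∈ F, ∀ B ∈ F, A ≠ B → IsSquare (n * ((∏ p ∈ A, p) * ∏ p ∈ B, p)) := by
    intro A hA B hB hAB
    have hsq := isSquare_mul_of_isSquare_mul_left hc (h A hA) (h B hB)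
    rw [← Nat.cast_mul] at hsq
    refine (realQuadField.isSquare_or_isSquare_mul hn hsq).resolve_left fun h' => hAB ?_
    exact Nat.eq_of_isSquare_prod_mul_prod (hF A hA) (hF B hB) h'
  apply hUV
  apply Nat.eq_of_isSquare_prod_mul_prod (hF U hU) (hF V hV)
  have h1 := key T hT U hU hTU
  have h2 := key T hT V hV hTV
  rw [← mul_assoc, ← Rat.isSquare_natCast_iff, Nat.cast_mul] at h1 h2
  rw [← Rat.isSquare_natCast_iff, Nat.cast_mul]
  refine isSquare_mul_of_isSquare_mul_left ?_ h1 h2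
  have hn0 : n ≠ 0 := by
    rintro rfl
    exact hn (IsSquare.zero)
  have hT0 : ∏ p ∈ T, p ≠ 0 := Finset.prod_ne_zero_iff.2 fun p hp => (hF T hT p hp).ne_zero
  exact_mod_cast mul_ne_zero hn0 hT0

/-! ### Ramified primes and the 2-torsion of the class group -/

theorem realQuadField.exists_ideal_sq_eq {n p c : ℕ} (hp : p ≠ 0) (hn : n = p * c)
    (hpc : Nat.Coprime p c) :
    ∃ P : (Ideal (𝓞 (realQuadField n)))⁰,
      (P : Ideal (𝓞 (realQuadField n))) ^ 2 = Ideal.span {(p : 𝓞 (realQuadField n))} := by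
  let s : realQuadField n :=
    ⟨√(n : ℝ), IntermediateField.mem_adjoin_simple_self ℚ _⟩
  have hs : s ^ 2 = n := by
    apply Subtype.ext
    simp [s]
  have hint : IsIntegral ℤ s :=
    ⟨Polynomial.X ^ 2 - Polynomial.C (n : ℤ), Polynomial.monic_X_pow_sub_C _ two_ne_zero,
      by simp [hs]⟩
  let θ : 𝓞 (realQuadField n) := ⟨s, hint⟩
  have hθ : θ ^ 2 = (p : 𝓞 (realQuadField n)) * c := by
    apply RingOfIntegers.coe_injective
    rw [← Nat.cast_mul, ← hn, map_pow, map_natCast]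
    exact hs
  have hcop : IsCoprime (p : 𝓞 (realQuadField n)) c := by
    simpa using (Nat.isCoprime_iff_coprime.2 hpc).map (Int.castRingHom (𝓞 (realQuadField n)))
  have hsq := Ideal.span_pair_sq_eq hθ hcop
  refine ⟨⟨Ideal.span {(p : 𝓞 (realQuadField n)), θ}, ?_⟩, hsq⟩
  rw [mem_nonZeroDivisors_iff_ne_zero]
  intro h0
  rw [h0, zero_pow two_ne_zero, eq_comm, Ideal.zero_eq_bot, Ideal.span_singleton_eq_bot] at hsq
  exact hp (by exact_mod_cast hsq)

theorem two_pow_dvd_quadClassNumber {n t : ℕ} {S : Finset ℕ} (hn : ¬ IsSquare n)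
    (hcard : S.card = t + 2) (hS : ∀ p ∈ S, p.Prime)
    (hdvd : ∀ p ∈ S, ∃ c, n = p * c ∧ Nat.Coprime p c) : 2 ^ t ∣ quadClassNumber n := by
  classical
  let K := realQuadField n
  let φ : K →+* ℝ := (algebraMap K ℝ)
  have hP : ∀ p : ℕ, ∃ P : (Ideal (𝓞 K))⁰, p ∈ S →
      (P : Ideal (𝓞 K)) ^ 2 = Ideal.span {(p : 𝓞 K)} := by
    intro p
    by_cases hp : p ∈ S
    · obtain ⟨c, hc, hpc⟩ := hdvd p hp
      obtain ⟨P, h⟩ := realQuadField.exists_ideal_sq_eq (hS p hp).ne_zero hc hpc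
      exact ⟨P, fun _ => h⟩
    · exact ⟨1, fun h => absurd h hp⟩
  choose P hP using hP
  have hprod : ∀ T ⊆ S, ((∏ p ∈ T, P p : (Ideal (𝓞 K))⁰) : Ideal (𝓞 K)) ^ 2 =
      Ideal.span {((∏ p ∈ T, p : ℕ) : 𝓞 K)} := by
    intro T hT
    rw [Submonoid.coe_finsetProd, ← Finset.prod_pow, Nat.cast_prod, ← Ideal.prod_span_singleton]
    exact Finset.prod_congr rfl fun p hp => hP p (hT hp)
  have hpos : ∀ T ⊆ S, 0 < ∏ p ∈ T, p := fun T hT =>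
    Finset.prod_pos fun p hp => (hS p (hT hp)).pos
  let f : Finset ℕ → ClassGroup (𝓞 K) := fun T => ClassGroup.mk0 (∏ p ∈ T, P p)
  let G : Subgroup (ClassGroup (𝓞 K)) := (powMonoidHom 2).ker
  have hfG : ∀ T ⊆ S, f T ∈ G := by
    intro T hT
    rw [MonoidHom.mem_ker, powMonoidHom_apply, ← map_pow, ClassGroup.mk0_eq_one_iff]
    rw [SubmonoidClass.coe_pow, hprod T hT]
    exact ⟨⟨_, rfl⟩⟩
  -- Since `G` is a 2-group, the bound on its order will become a divisibility.
  obtain ⟨s, hs⟩ : ∃ s, Nat.card G = 2 ^ s := by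
    refine IsPGroup.iff_card.1 fun g => ⟨1, ?_⟩
    apply Subtype.ext
    simpa [G, MonoidHom.mem_ker] using MonoidHom.mem_ker.1 g.2
  obtain ⟨ε, hε⟩ := exists_unit_isSquare_or_isSquare_mul φ (realQuadField.finrank_le n)
  have hfiber : ∀ g ∈ (Finset.univ.filter (· ∈ G)),
      (S.powerset.filter (fun T => f T = g)).card ≤ 4 := by
    intro g _
    rcases (S.powerset.filter (fun T => f T = g)).eq_empty_or_nonempty with h | ⟨U, hU⟩
    · simp [h]
    rw [Finset.mem_filter, Finset.mem_powerset] at hU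
    -- With `U` fixed in the fiber, each `T` in it satisfies one of two square conditions, for the
    -- units `1` and `ε`; each allows at most two `T`.
    let a : Finset ℕ → K := fun T => ((∏ p ∈ T, p : ℕ) : K)
    have haU : a U ≠ 0 := Nat.cast_ne_zero.2 (hpos U hU.1).ne'
    have hsub : S.powerset.filter (fun T => f T = g) ⊆
        S.powerset.filter (fun T => IsSquare (a U * a T)) ∪
        S.powerset.filter (fun T => IsSquare ((ε : K) * a U * a T)) := by
      intro T hT
      rw [Finset.mem_filter, Finset.mem_powerset] at hT
      obtain ⟨u, hu, hsq⟩ := exists_unit_isSquare_of_mk0_eq φ (hpos U hU.1) (hpos T hT.1)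
        (hprod U hU.1) (hprod T hT.1) (hU.2.trans hT.2.symm)
      have hu0 : (u : K) ≠ 0 := Units.coe_ne_zero u
      rw [Finset.mem_union, Finset.mem_filter, Finset.mem_filter, Finset.mem_powerset]
      rcases hε u hu with ⟨v, rfl⟩ | ⟨v, hv⟩
      · refine Or.inl ⟨hT.1, ?_⟩
        refine (one_mul (a U * a T)) ▸ isSquare_mul_of_isSquare_mul_left hu0 ?_ hsq
        exact ⟨v, by simp⟩
      · refine Or.inr ⟨hT.1, ?_⟩
        rw [mul_assoc]
        refine isSquare_mul_of_isSquare_mul_left hu0 ⟨v, ?_⟩ hsq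
        have := congrArg (fun w : (𝓞 K)ˣ => (w : K)) hv
        rw [mul_comm]
        simpa using this
    have hprime : ∀ q : Finset ℕ → Prop, ∀ T ∈ S.powerset.filter q, ∀ p ∈ T, p.Prime :=
      fun q T hT p hp => hS p (Finset.mem_powerset.1 (Finset.mem_filter.1 hT).1 hp)
    have h1 := realQuadField.card_le_two hn (hprime fun T => IsSquare (a U * a T)) haU
      fun T hT => (Finset.mem_filter.1 hT).2
    have h2 := realQuadField.card_le_two hn (hprime fun T => IsSquare ((ε : K) * a U * a T))
      (mul_ne_zero (Units.coe_ne_zero ε) haU) fun T hT => (Finset.mem_filter.1 hT).2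
    exact (Finset.card_le_card hsub).trans ((Finset.card_union_le _ _).trans (by omega))
  have hcount := Finset.card_le_mul_card_image_of_maps_to (f := f) (s := S.powerset)
    (fun T hT => by simpa using hfG T (Finset.mem_powerset.1 hT)) 4 hfiber
  have hG : (Finset.univ.filter (· ∈ G)).card = 2 ^ s := by
    rw [← hs, Nat.card_eq_fintype_card, Fintype.card_subtype]
  rw [Finset.card_powerset, hcard, hG, show 4 = 2 ^ 2 from rfl, ← pow_add,
    Nat.pow_le_pow_iff_right one_lt_two] at hcount
  have hts : t ≤ s := by omega
  refine (pow_dvd_pow 2 hts).trans ?_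
  rw [← hs, quadClassNumber, NumberField.classNumber, ← Nat.card_eq_fintype_card]
  exact Subgroup.card_subgroup_dvd_card G

/-! ### Multiples `j * d` and infinitude -/

theorem quadClassNumber_mul_prod {k t : ℕ} {S : Finset ℕ} (hcard : S.card = t + 2)
    (hS : ∀ p ∈ S, p.Prime ∧ k < p) {j : ℕ} (hj : 1 ≤ j) (hjk : j ≤ k) :
    ¬ IsSquare (j * ∏ p ∈ S, p) ∧ 2 ^ t ∣ quadClassNumber (j * ∏ p ∈ S, p) := by
  have hdvd : ∀ p ∈ S, ∃ c, j * ∏ p ∈ S, p = p * c ∧ Nat.Coprime p c := by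
    intro p hp
    refine ⟨j * ∏ q ∈ S.erase p, q, ?_, Nat.Coprime.mul_right ?_ ?_⟩
    · rw [← Finset.mul_prod_erase S _ hp]
      ring
    · exact (Nat.coprime_of_lt_prime (by omega) (hjk.trans_lt (hS p hp).2) (hS p hp).1)
    · refine Nat.Coprime.prod_right fun q hq => ?_
      rw [Finset.mem_erase] at hq
      exact (Nat.coprime_primes (hS p hp).1 (hS q hq.2).1).2 hq.1.symm
  have hsq : ¬ IsSquare (j * ∏ p ∈ S, p) := by
    intro h
    obtain ⟨p, hp⟩ : S.Nonempty := Finset.card_pos.1 (by omega)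
    obtain ⟨c, hc, hpc⟩ := hdvd p hp
    rw [hc] at h
    have h2 := (hS p hp).1.sq_dvd_of_isSquare h (dvd_mul_right p c)
    rw [pow_two] at h2
    have h3 : p ∣ c := Nat.dvd_of_mul_dvd_mul_left (hS p hp).1.pos h2
    exact (hS p hp).1.one_lt.ne' (Nat.eq_one_of_dvd_coprimes hpc dvd_rfl h3)
  exact ⟨hsq, two_pow_dvd_quadClassNumber hsq hcard (fun p hp => (hS p hp).1) hdvd⟩

theorem theorem5p4 (k : ℕ) (hk : 1 ≤ k) (M : ℝ) (hM : 0 < M) :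
    {d : ℕ | 0 < d ∧ Squarefree d ∧ ∀ j : ℕ, 1 ≤ j → j ≤ k →
        ¬ IsSquare (j * d) ∧ M < (quadClassNumber (j * d) : ℝ)}.Infinite ∧
    ∀ (t : ℕ) (S : Finset ℕ), S.card = t + 2 → (∀ p ∈ S, p.Prime ∧ k < p) →
      M < (2 : ℝ) ^ t →
      Squarefree (∏ p ∈ S, p) ∧ ∀ j : ℕ, 1 ≤ j → j ≤ k →
        ¬ IsSquare (j * ∏ p ∈ S, p) ∧
        2 ^ t ∣ quadClassNumber (j * ∏ p ∈ S, p) ∧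
        M < (quadClassNumber (j * ∏ p ∈ S, p) : ℝ) := by
  have main : ∀ (t : ℕ) (S : Finset ℕ), S.card = t + 2 → (∀ p ∈ S, p.Prime ∧ k < p) →
      M < (2 : ℝ) ^ t →
      Squarefree (∏ p ∈ S, p) ∧ ∀ j : ℕ, 1 ≤ j → j ≤ k →
        ¬ IsSquare (j * ∏ p ∈ S, p) ∧
        2 ^ t ∣ quadClassNumber (j * ∏ p ∈ S, p) ∧
        M < (quadClassNumber (j * ∏ p ∈ S, p) : ℝ) := by
    intro t S hcard hS hMt
    refine ⟨Nat.squarefree_prod_of_forall_prime fun p hp => (hS p hp).1, fun j hj hjk => ?_⟩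
    obtain ⟨hsq, hdvd⟩ := quadClassNumber_mul_prod hcard hS hj hjk
    refine ⟨hsq, hdvd, hMt.trans_le ?_⟩
    exact_mod_cast Nat.le_of_dvd (NumberField.classNumber_pos _) hdvd
  refine ⟨?_, main⟩
  apply Set.infinite_of_forall_exists_gt
  intro N
  obtain ⟨t, ht⟩ := pow_unbounded_of_one_lt M (one_lt_two (α := ℝ))
  -- Primes beyond `k` meet the hypothesis of `main`; primes beyond `N` force `d > N`.
  have hinf : {p : ℕ | p.Prime ∧ max k N < p}.Infinite :=
    Set.infinite_of_forall_exists_gt fun m => by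
      obtain ⟨p, hp, hpp⟩ := Nat.exists_infinite_primes (max m (max k N) + 1)
      exact ⟨p, ⟨hpp, by omega⟩, by omega⟩
  obtain ⟨S, hSsub, hcard⟩ := hinf.exists_subset_card_eq (t + 2)
  have hS : ∀ p ∈ S, p.Prime ∧ k < p := fun p hp =>
    ⟨(hSsub hp).1, (le_max_left _ _).trans_lt (hSsub hp).2⟩
  obtain ⟨hsf, h⟩ := main t S hcard hS ht
  have hpos : 0 < ∏ p ∈ S, p := Finset.prod_pos fun p hp => (hS p hp).1.pos
  refine ⟨∏ p ∈ S, p, ⟨hpos, hsf, fun j hj hjk => ⟨(h j hj hjk).1, (h j hj hjk).2.2⟩⟩, ?_⟩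
  obtain ⟨p, hp⟩ : S.Nonempty := Finset.card_pos.1 (by omega)
  exact ((le_max_right _ _).trans_lt (hSsub hp).2).trans_le
    (Nat.le_of_dvd hpos (Finset.dvd_prod_of_mem _ hp))
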